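/- Let $\mathbb K$ be a field of characteristic $0$, $\mathcal S=\mathbb K[x_0,\dots,x_n]$, $R=\mathbb K[x_1,\dots,x_n]$, $\boldsymbol x=(x_1,\dots,x_n)$. A formal power series $\varphi=\sum_\alpha \varphi_\alpha \frac{z^\alpha}{\alpha!}$ in the dual variables is identified with the linear functional on polynomials given by $x^\alpha\mapsto\varphi_\alpha$, and $p\star\varphi$ denotes the functional $q\mapsto\varphi(pq)$. For a point $\xi$ put $\boldsymbol e_{\xi}(z)=\sum_\alpha \xi^\alpha\frac{z^\alpha}{\alpha!}$. Let $s\ge 1$ and let $f=\sum_{i=1}^s\omega_i\,\ell_i^{\,d-k_i}\in\mathcal S_d$ be a generalized additive decomposition (GAD): $0\le k_i\le d$, $\omega_i\in\mathcal S_{k_i}$, the linear forms $\ell_i=\sum_{j=0}^n\underline\xi_{i,j}x_j$ are pairwise non-proportional, and $\ell_i\nmid\omega_i$. Assume $\underline\xi_{i,0}=1$ for all $i$, and write $\underline\xi_i=(1,\xi_i)$ with $\xi_i\in\mathbb K^n$. Write uniquely $\omega_i=\sum_{j=0}^{k_i}\omega_{i,j}\,\ell_i^{\,k_i-j}$ with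 $\omega_{i,j}\in R$ homogeneous of degree $j$, and set $$\omega_i^{d,\ell_i,\boldsymbol x}=\frac1{d!}\sum_{j=0}^{k_i}(d-j)!\,\omega_{i,j}\in R .$$ Consider the series $$\varphi=\sum_{i=1}^s\omega_i^{d,\ell_i,\boldsymbol x}(\boldsymbol z)\,\boldsymbol e_{\xi_i}(\boldsymbol z)\in\mathbb K[[z_1,\dots,z_n]],\qquad \underline\varphi=\sum_{i=1}^s\omega_i^{d,\ell_i,\boldsymbol x}(\boldsymbol z)\,\boldsymbol e_{\ell_i}(\underline{\boldsymbol z})\in\mathbb K[[z_0,\dots,z_n]],$$ where $\boldsymbol e_{\ell_i}=\boldsymbol e_{\underline\xi_i}$. Let $I_\varphi=\{p\in R: p\star\varphi=0\}$, and for a series $\psi\in\mathbb K[[z_0,\dots,z_n]]$ let $\mathrm{Ann}(\psi)\subseteq\mathcal S$ be the homogeneous ideal spanned by the homogeneous polynomials $p$ with $p\star\psi=0$; put $I_{\underline\varphi}=\mathrm{Ann}(\underline\varphi)$. Then: 1. $I_{\underline\varphi}$ is saturated, i.e. $\big(I_{\underline\varphi}:(x_0,\dots,x_n)\big)=I_{\underline\varphi}$;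 2. $I_{\underline\varphi}$ defines a zero-dimensional projective scheme (i.e. $\dim\mathcal S/I_{\underline\varphi}=1$) whose support is exactly $\{\underline\xi_1,\dots,\underline\xi_s\}$, that is, the homogeneous prime ideals containing $I_{\underline\varphi}$ but not $(x_0,\dots,x_n)$ are exactly the ideals of the points $\underline\xi_1,\dots,\underline\xi_s\in\mathbb P^n(\mathbb K)$; 3. $I_{\underline\varphi}=\mathfrak h_{x_0}(I_\varphi)=\bigcap_{i=1}^s\mathrm{Ann}\big(\omega_i^{d,\ell_i,\boldsymbol x}\,\boldsymbol e_{\ell_i}\big)$, where $\mathfrak h_{x_0}(I_\varphi)$ is the ideal generated by the homogenizations $x_0^{\deg p}\,p(x_1/x_0,\dots,x_n/x_0)$ of the elements $p\in I_\varphi$. -/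

import Mathlib

open MvPolynomial

attribute [local instance] MvPolynomial.gradedAlgebra

noncomputable section

namespace GADIdeal

variable {K : Type*} [Field K]

/-! ### Power series as linear functionals on polynomials -/

section Duality

variable {σ : Type*}

/-- The product of factorials of the entries of a multi-index. -/
def multiFactorial (α : σ →₀ ℕ) : ℕ := α.prod fun _ k => k.factorial

/-- The linear functional on `K[x]` represented by a formal power series in the dual variables `z`:
the monomial `z ^ α` acts as `p ↦ (∂ ^ α p)(0)`, so that a series with coefficients `c α`
sends `x ^ α` to `α! * c α`. -/
def toFunctional (φ : MvPowerSeries σ K) : MvPolynomial σ K →ₗ[K] K :=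
  (MvPolynomial.basisMonomials σ K).constr K
    fun α => (multiFactorial α : K) * MvPowerSeries.coeff α φ

/-- The co-product `p ⋆ φ`, that is the functional `q ↦ ⟨φ, p q⟩`. -/
def coprod (p : MvPolynomial σ K) (φ : MvPowerSeries σ K) : MvPolynomial σ K →ₗ[K] K :=
  toFunctional φ ∘ₗ LinearMap.mulLeft K p

/-- The exponential series `e_ξ(z) = ∑ α, ξ ^ α z ^ α / α!`. -/
def expSeries (ξ : σ → K) : MvPowerSeries σ K :=
  fun α => (α.prod fun j k => ξ j ^ k) / (multiFactorial α : K)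

/-- The annihilator `{p | p ⋆ φ = 0}` of a series. -/
def ann (φ : MvPowerSeries σ K) : Ideal (MvPolynomial σ K) where
  carrier := {p | coprod p φ = 0}
  add_mem' := by
    intro a b ha hb
    apply LinearMap.ext
    intro q
    have h1 := LinearMap.congr_fun ha q
    have h2 := LinearMap.congr_fun hb q
    simp only [coprod, LinearMap.comp_apply, LinearMap.mulLeft_apply, LinearMap.zero_apply]
      at h1 h2 ⊢
    rw [add_mul, map_add, h1, h2, add_zero]
  zero_mem' := by
    ext q
    simp [coprod]
  smul_mem' := by
    intro c a ha
    apply LinearMap.ext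
    intro q
    have h1 := LinearMap.congr_fun ha (c * q)
    simp only [coprod, LinearMap.comp_apply, LinearMap.mulLeft_apply, LinearMap.zero_apply] at h1 ⊢
    rw [← h1, smul_eq_mul]
    congr 1
    ring

/-- The homogeneous annihilator of a series: the ideal generated by the homogeneous
polynomials `p` with `p ⋆ φ = 0`. -/
def homAnn (φ : MvPowerSeries σ K) : Ideal (MvPolynomial σ K) :=
  Ideal.span {p | ∃ k : ℕ, p.IsHomogeneous k ∧ coprod p φ = 0}

/-- The homogeneous annihilator is already the `K`-linear span of the homogeneous polynomials
that annihilate the series. -/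
theorem homAnn_eq_span (φ : MvPowerSeries σ K) :
    (homAnn φ).restrictScalars K =
      Submodule.span K {p | ∃ k : ℕ, p.IsHomogeneous k ∧ coprod p φ = 0} := by
  apply le_antisymm
  · intro p hp
    have hp' : p ∈ homAnn φ := hp
    refine Submodule.span_induction (p := fun p _ => p ∈ Submodule.span K
      {p : MvPolynomial σ K | ∃ k : ℕ, p.IsHomogeneous k ∧ coprod p φ = 0})
      (fun x hx => Submodule.subset_span hx) (Submodule.zero_mem _)
      (fun x y _ _ hx hy => Submodule.add_mem _ hx hy) ?_ hp'
    intro a x hx1 hx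
    clear hx1 hp hp'
    induction hx using Submodule.span_induction with
    | mem x hx =>
      obtain ⟨k, hk, h0⟩ := hx
      rw [smul_eq_mul, ← MvPolynomial.sum_homogeneousComponent a, Finset.sum_mul]
      refine Submodule.sum_mem _ fun i _ => Submodule.subset_span
        ⟨i + k, (homogeneousComponent_isHomogeneous i a).mul hk, ?_⟩
      exact (ann φ).mul_mem_left _ (show x ∈ ann φ from h0)
    | zero => simp
    | add x y _ _ hx hy => rw [smul_add]; exact Submodule.add_mem _ hx hy
    | smul c x _ hx => rw [smul_comm]; exact Submodule.smul_mem _ _ hx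
  · rw [Submodule.span_le]
    intro p hp
    exact Ideal.subset_span hp

end Duality

/-! ### Homogeneous ideals and projective schemes -/

section Projective

variable {n : ℕ}

/-- `I` is saturated: `(I : (x_0, …, x_n)) = I`. -/
def IsSaturated (I : Ideal (MvPolynomial (Fin (n + 1)) K)) : Prop :=
  I.colon (Ideal.span (Set.range fun j : Fin (n + 1) => (X j : MvPolynomial (Fin (n + 1)) K)) :
    Set (MvPolynomial (Fin (n + 1)) K)) = I

/-- The projective scheme of `I` is zero-dimensional: its affine cone has dimension one. -/
def IsProjZeroDimensional (I : Ideal (MvPolynomial (Fin (n + 1)) K)) : Prop :=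
  ringKrullDim (MvPolynomial (Fin (n + 1)) K ⧸ I) = 1

/-- The homogeneous ideal of the point `(ξ_0 : … : ξ_n)` of projective space, generated by
the forms `ξ_j x_k - ξ_k x_j`. -/
def pointIdeal (ξ : Fin (n + 1) → K) : Ideal (MvPolynomial (Fin (n + 1)) K) :=
  Ideal.span (Set.range fun jk : Fin (n + 1) × Fin (n + 1) =>
    C (ξ jk.1) * X jk.2 - C (ξ jk.2) * X jk.1)

/-- The support of the projective scheme of `I`, as the set of the homogeneous prime ideals that
contain `I` and do not contain the irrelevant ideal. -/
def projSupport (I : Ideal (MvPolynomial (Fin (n + 1)) K)) :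
    Set (Ideal (MvPolynomial (Fin (n + 1)) K)) :=
  (fun P => P.asHomogeneousIdeal.toIdeal) ''
    ProjectiveSpectrum.zeroLocus (MvPolynomial.homogeneousSubmodule (Fin (n + 1)) K)
      (I : Set (MvPolynomial (Fin (n + 1)) K))

/-- The homogenization `x_0 ^ d * p (x_1 / x_0, …, x_n / x_0)` in degree `d`, for `p` of degree
at most `d`. -/
def homogenizeDeg (d : ℕ) (p : MvPolynomial (Fin n) K) : MvPolynomial (Fin (n + 1)) K :=
  ∑ α ∈ p.support, C (p.coeff α) * X 0 ^ (d - α.degree) * rename Fin.succ (monomial α 1)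

/-- The homogenization with respect to `x_0` of an ideal: the ideal generated by the
homogenizations of its elements, each in its own degree. -/
def homogenizeIdeal (I : Ideal (MvPolynomial (Fin n) K)) : Ideal (MvPolynomial (Fin (n + 1)) K) :=
  Ideal.span ((fun p => homogenizeDeg p.totalDegree p) '' (I : Set (MvPolynomial (Fin n) K)))

end Projective

/-! ### The polynomial attached to a form and a linear form -/

section LocalPolynomial

variable {n : ℕ}

/-- The linear form `ξ_0 x_0 + … + ξ_n x_n`. -/
def linForm (ξ : Fin (n + 1) → K) : MvPolynomial (Fin (n + 1)) K :=
  ∑ j, C (ξ j) * X j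

/-- The rewriting of a polynomial in `x_0, …, x_n` as a polynomial in `ℓ = linForm ξ` with
coefficients in `K[x_1, …, x_n]`, for `ξ_0 ≠ 0`: here `Polynomial.X` stands for `ℓ`, and
`x_0 = ξ_0⁻¹ (ℓ - ξ_1 x_1 - … - ξ_n x_n)`. -/
def expandAlong (ξ : Fin (n + 1) → K) :
    MvPolynomial (Fin (n + 1)) K →ₐ[K] Polynomial (MvPolynomial (Fin n) K) :=
  aeval (Fin.cons
    (Polynomial.C (C (ξ 0)⁻¹) *
      (Polynomial.X - Polynomial.C (∑ j : Fin n, C (ξ j.succ) * X j)))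
    (fun j : Fin n => Polynomial.C (X j)))

/-- The component `ω_j` of degree `j` in the decomposition `ω = ∑_{j ≤ k} ω_j ℓ ^ (k - j)` of a
form `ω` of degree `k`, where `ω_j` is a form of degree `j` in `x_1, …, x_n`. -/
def component (ξ : Fin (n + 1) → K) (k : ℕ) (ω : MvPolynomial (Fin (n + 1)) K) (j : ℕ) :
    MvPolynomial (Fin n) K :=
  (expandAlong ξ ω).coeff (k - j)

/-- The polynomial `(1 / d!) ∑_{j ≤ k} (d - j)! ω_j` in `x_1, …, x_n`. -/
def localPoly (d : ℕ) (ξ : Fin (n + 1) → K) (k : ℕ) (ω : MvPolynomial (Fin (n + 1)) K) :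
    MvPolynomial (Fin n) K :=
  C ((d.factorial : K)⁻¹) *
    ∑ j ∈ Finset.range (k + 1), C ((d - j).factorial : K) * component ξ k ω j

/-- Joint homogeneity of degree `k` in the variable of the outer polynomial ring and the
variables of the inner one. -/
def JointHomogeneous (k : ℕ) (W : Polynomial (MvPolynomial (Fin n) K)) : Prop :=
  ∀ m α, MvPolynomial.coeff α (W.coeff m) ≠ 0 → m + α.degree = k

theorem JointHomogeneous.add {k : ℕ} {U V : Polynomial (MvPolynomial (Fin n) K)}
    (hU : JointHomogeneous k U) (hV : JointHomogeneous k V) : JointHomogeneous k (U + V) := by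
  intro m α h
  rw [Polynomial.coeff_add, MvPolynomial.coeff_add] at h
  by_cases h1 : MvPolynomial.coeff α (U.coeff m) = 0
  · rw [h1, zero_add] at h
    exact hV m α h
  · exact hU m α h1

theorem JointHomogeneous.sum {ι : Type*} {k : ℕ} (s : Finset ι)
    (U : ι → Polynomial (MvPolynomial (Fin n) K)) (hU : ∀ i ∈ s, JointHomogeneous k (U i)) :
    JointHomogeneous k (∑ i ∈ s, U i) := by
  classical
  induction s using Finset.induction_on with
  | empty => intro m α h; simp at h
  | insert a s ha ih =>
    rw [Finset.sum_insert ha]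
    exact (hU a (by simp)).add (ih fun i hi => hU i (by simp [hi]))

theorem JointHomogeneous.mul {a b : ℕ} {U V : Polynomial (MvPolynomial (Fin n) K)}
    (hU : JointHomogeneous a U) (hV : JointHomogeneous b V) :
    JointHomogeneous (a + b) (U * V) := by
  intro m α h
  rw [Polynomial.coeff_mul, MvPolynomial.coeff_sum] at h
  obtain ⟨x, hx, h⟩ := Finset.exists_ne_zero_of_sum_ne_zero h
  rw [MvPolynomial.coeff_mul] at h
  obtain ⟨y, hy, h⟩ := Finset.exists_ne_zero_of_sum_ne_zero h
  have h1 := hU _ _ (left_ne_zero_of_mul h)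
  have h2 := hV _ _ (right_ne_zero_of_mul h)
  rw [Finset.HasAntidiagonal.mem_antidiagonal] at hx hy
  rw [← hx, ← hy, map_add]
  omega

theorem JointHomogeneous.one : JointHomogeneous 0 (1 : Polynomial (MvPolynomial (Fin n) K)) := by
  intro m α h
  rw [Polynomial.coeff_one] at h
  split_ifs at h with hm
  · rw [MvPolynomial.coeff_one] at h
    split_ifs at h with hα
    · subst hm; subst hα; simp
    · exact absurd rfl h
  · simp at h

theorem JointHomogeneous.const {k : ℕ} {p : MvPolynomial (Fin n) K} (hp : p.IsHomogeneous k) :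
    JointHomogeneous k (Polynomial.C p) := by
  intro m α h
  rw [Polynomial.coeff_C] at h
  split_ifs at h with hm
  · have := hp h
    rw [show (Finsupp.weight 1) α = α.degree from by
      rw [Finsupp.degree_eq_weight_one]; rfl] at this
    subst hm
    rw [zero_add]
    exact this
  · simp at h

theorem JointHomogeneous.var :
    JointHomogeneous 1 (Polynomial.X : Polynomial (MvPolynomial (Fin n) K)) := by
  intro m α h
  rw [Polynomial.coeff_X] at h
  split_ifs at h with hm
  · rw [MvPolynomial.coeff_one] at h
    split_ifs at h with hα
    · subst hm; subst hα; simp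
    · exact absurd rfl h
  · simp at h

theorem JointHomogeneous.pow {a : ℕ} {U : Polynomial (MvPolynomial (Fin n) K)}
    (hU : JointHomogeneous a U) (e : ℕ) : JointHomogeneous (e * a) (U ^ e) := by
  induction e with
  | zero => simpa using JointHomogeneous.one
  | succ e ih => rw [pow_succ, Nat.succ_mul]; exact ih.mul hU

theorem JointHomogeneous.prod {ι : Type*} (s : Finset ι) (a : ι → ℕ)
    (U : ι → Polynomial (MvPolynomial (Fin n) K)) (hU : ∀ i ∈ s, JointHomogeneous (a i) (U i)) :
    JointHomogeneous (∑ i ∈ s, a i) (∏ i ∈ s, U i) := by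
  classical
  induction s using Finset.induction_on with
  | empty => simpa using JointHomogeneous.one
  | insert b s hb ih =>
    rw [Finset.sum_insert hb, Finset.prod_insert hb]
    exact (hU b (by simp)).mul (ih fun i hi => hU i (by simp [hi]))

theorem jointHomogeneous_expandAlong (ξ : Fin (n + 1) → K) {k : ℕ}
    {ω : MvPolynomial (Fin (n + 1)) K} (hω : ω.IsHomogeneous k) :
    JointHomogeneous k (expandAlong ξ ω) := by
  have hvar : ∀ i : Fin (n + 1), JointHomogeneous 1 (expandAlong ξ (X i)) := by
    intro i
    rw [expandAlong, aeval_X]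
    refine Fin.cases ?_ (fun j => ?_) i
    · rw [Fin.cons_zero, sub_eq_add_neg, ← Polynomial.C_neg]
      change JointHomogeneous (0 + 1) _
      refine (JointHomogeneous.const (isHomogeneous_C _ _)).mul
        (JointHomogeneous.var.add (JointHomogeneous.const ?_))
      rw [← Finset.sum_neg_distrib]
      refine IsHomogeneous.sum _ _ _ fun j _ => ?_
      rw [← neg_mul, ← C_neg]
      exact (isHomogeneous_C_mul_X _ _)
    · rw [Fin.cons_succ]
      exact JointHomogeneous.const (isHomogeneous_X _ _)
  rw [ω.as_sum, map_sum]
  refine JointHomogeneous.sum _ _ fun α hα => ?_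
  have hdeg : ∑ i ∈ α.support, α i * 1 = k := by
    have := hω (mem_support_iff.1 hα)
    rw [show (Finsupp.weight 1) α = α.degree from by
      rw [Finsupp.degree_eq_weight_one]; rfl] at this
    simp only [mul_one]
    exact this
  rw [monomial_eq, map_mul, Finsupp.prod, map_prod, ← hdeg, ← zero_add (∑ i ∈ α.support, α i * 1)]
  refine JointHomogeneous.mul ?_ (JointHomogeneous.prod _ _ _ fun i _ => ?_)
  · rw [← algebraMap_eq, AlgHom.commutes]
    exact JointHomogeneous.const (isHomogeneous_C _ _)
  · rw [map_pow]
    exact (hvar i).pow _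

/-- The components are forms of the right degree. -/
theorem component_isHomogeneous (ξ : Fin (n + 1) → K) {k : ℕ}
    {ω : MvPolynomial (Fin (n + 1)) K} (hω : ω.IsHomogeneous k) {j : ℕ} (hj : j ≤ k) :
    (component ξ k ω j).IsHomogeneous j := by
  intro α hα
  have := jointHomogeneous_expandAlong ξ hω _ _ hα
  rw [show (Finsupp.weight 1) α = α.degree from by
    rw [Finsupp.degree_eq_weight_one]; rfl]
  omega

theorem linForm_eq (ξ : Fin (n + 1) → K) :
    linForm ξ = C (ξ 0) * X 0 + ∑ j : Fin n, C (ξ j.succ) * X j.succ := by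
  rw [linForm, Fin.sum_univ_succ]

/-- The components decompose the form. -/
theorem sum_component (ξ : Fin (n + 1) → K) (hξ : ξ 0 ≠ 0) {k : ℕ}
    {ω : MvPolynomial (Fin (n + 1)) K} (hω : ω.IsHomogeneous k) :
    ω = ∑ j ∈ Finset.range (k + 1),
      rename Fin.succ (component ξ k ω j) * linForm ξ ^ (k - j) := by
  have hid : ∀ p : MvPolynomial (Fin (n + 1)) K,
      Polynomial.eval₂ (rename Fin.succ : MvPolynomial (Fin n) K →ₐ[K] _).toRingHom
        (linForm ξ) (expandAlong ξ p) = p := by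
    intro p
    induction p using MvPolynomial.induction_on with
    | C a =>
      rw [← algebraMap_eq, AlgHom.commutes, Polynomial.algebraMap_apply, Polynomial.eval₂_C,
        algebraMap_eq]
      simp
    | add p q hp hq => rw [map_add, Polynomial.eval₂_add, hp, hq]
    | mul_X p i hp =>
      rw [map_mul, Polynomial.eval₂_mul, hp]
      congr 1
      rw [expandAlong, aeval_X]
      refine Fin.cases ?_ (fun j => ?_) i
      · rw [Fin.cons_zero]
        simp only [Polynomial.eval₂_mul, Polynomial.eval₂_sub, Polynomial.eval₂_C,
          Polynomial.eval₂_X]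
        simp only [AlgHom.toRingHom_eq_coe, RingHom.coe_coe, map_sum, map_mul, rename_C, rename_X]
        rw [linForm_eq, add_sub_cancel_right, ← mul_assoc, ← C_mul, inv_mul_cancel₀ hξ, C_1,
          one_mul]
      · rw [Fin.cons_succ, Polynomial.eval₂_C]
        simp
  have hdeg : (expandAlong ξ ω).natDegree < k + 1 := by
    rw [Nat.lt_succ_iff, Polynomial.natDegree_le_iff_coeff_eq_zero]
    intro m hm
    by_contra hne
    obtain ⟨α, hα⟩ := MvPolynomial.ne_zero_iff.1 hne
    have := jointHomogeneous_expandAlong ξ hω _ _ hα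
    omega
  conv_lhs => rw [← hid ω, Polynomial.eval₂_eq_sum_range' _ hdeg, ← Finset.sum_range_reflect]
  refine Finset.sum_congr rfl fun j hj => ?_
  rw [Nat.add_sub_cancel]
  rfl

/-- The decomposition is unique. -/
theorem component_unique (ξ : Fin (n + 1) → K) (hξ : ξ 0 ≠ 0) (k : ℕ)
    (c : ℕ → MvPolynomial (Fin n) K) {j : ℕ} (hj : j ≤ k) :
    component ξ k (∑ i ∈ Finset.range (k + 1), rename Fin.succ (c i) * linForm ξ ^ (k - i)) j
      = c j := by
  have hren : ∀ p : MvPolynomial (Fin n) K, expandAlong ξ (rename Fin.succ p) = Polynomial.C p := by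
    intro p
    induction p using MvPolynomial.induction_on with
    | C a =>
      rw [rename_C, ← algebraMap_eq, AlgHom.commutes, Polynomial.algebraMap_apply, algebraMap_eq]
    | add p q hp hq => rw [map_add, map_add, hp, hq, Polynomial.C_add]
    | mul_X p i hp =>
      rw [map_mul, map_mul, hp, rename_X, Polynomial.C_mul]
      congr 1
      rw [expandAlong, aeval_X, Fin.cons_succ]
  have hlin : expandAlong ξ (linForm ξ) = Polynomial.X := by
    have h1 : (∑ j : Fin n, C (ξ j.succ) * X j.succ : MvPolynomial (Fin (n + 1)) K)
        = rename Fin.succ (∑ j : Fin n, C (ξ j.succ) * X j) := by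
      simp
    rw [linForm_eq, h1, map_add, hren, map_mul, ← algebraMap_eq, AlgHom.commutes,
      Polynomial.algebraMap_apply, algebraMap_eq, expandAlong, aeval_X, Fin.cons_zero, ← mul_assoc,
      ← Polynomial.C_mul, ← C_mul, mul_inv_cancel₀ hξ]
    simp
  rw [component, map_sum, Polynomial.finsetSum_coeff, Finset.sum_eq_single j]
  · rw [map_mul, map_pow, hren, hlin]
    simp
  · intro i hi hij
    rw [Finset.mem_range] at hi
    rw [map_mul, map_pow, hren, hlin, Polynomial.coeff_C_mul, Polynomial.coeff_X_pow,
      if_neg (by omega), mul_zero]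
  · intro h
    exact absurd (Finset.mem_range.2 (by omega)) h

end LocalPolynomial

/-! ### Generalized additive decompositions -/

/-- A generalized additive decomposition `f = ∑_i ω_i ℓ_i ^ (d - k_i)` with `s` terms of
`f ∈ K[x_0, …, x_n]_d`, where `ℓ_i = linForm (point i)`. -/
structure GAD {n : ℕ} (d s : ℕ) (f : MvPolynomial (Fin (n + 1)) K) where
  /-- The degrees `k_i` of the `ω_i`. -/
  k : Fin s → ℕ
  /-- The coefficient vectors of the linear forms `ℓ_i`. -/
  point : Fin s → Fin (n + 1) → K
  /-- The forms `ω_i`. -/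
  ω : Fin s → MvPolynomial (Fin (n + 1)) K
  k_le : ∀ i, k i ≤ d
  ω_homogeneous : ∀ i, (ω i).IsHomogeneous (k i)
  not_proportional : ∀ i j, i ≠ j → ∀ c : K, linForm (point i) ≠ c • linForm (point j)
  not_dvd : ∀ i, ¬ linForm (point i) ∣ ω i
  eq_sum : f = ∑ i, ω i * linForm (point i) ^ (d - k i)

namespace GAD

variable {n d s : ℕ} {f : MvPolynomial (Fin (n + 1)) K}

/-- The polynomial `ω_i ^ {d, ℓ_i, x}` in the variables `x_1, …, x_n`. -/
def poly (G : GAD d s f) (i : Fin s) : MvPolynomial (Fin n) K :=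
  localPoly d (G.point i) (G.k i) (G.ω i)

/-- The affine series `φ = ∑_i ω_i ^ {d, ℓ_i, x}(z) e_{ξ_i}(z)` in `z_1, …, z_n`, where
`ξ_i = (ξ_{i,1}, …, ξ_{i,n})`. -/
def affineSeries (G : GAD d s f) : MvPowerSeries (Fin n) K :=
  ∑ i, (G.poly i : MvPowerSeries (Fin n) K) * expSeries (Fin.tail (G.point i))

/-- The series `ω_i ^ {d, ℓ_i, x}(z) e_{ℓ_i}(z)` in `z_0, …, z_n`. -/
def homTerm (G : GAD d s f) (i : Fin s) : MvPowerSeries (Fin (n + 1)) K :=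
  (rename Fin.succ (G.poly i) : MvPolynomial (Fin (n + 1)) K) * expSeries (G.point i)

/-- The homogenized series `∑_i ω_i ^ {d, ℓ_i, x} e_{ℓ_i}` in `z_0, …, z_n`. -/
def homSeries (G : GAD d s f) : MvPowerSeries (Fin (n + 1)) K :=
  ∑ i, G.homTerm i

end GAD

end GADIdeal

end

/-!
A series `w(z) e_ξ(z)` with `w` a polynomial acts on a polynomial `q` as `(w(∂) q)(ξ)`, because
multiplication by `z_i` is dual to `∂_i` (`toFunctional_X_mul`) and `e_ξ` is evaluation at `ξ`
(`toFunctional_expSeries`). Its annihilator therefore contains a power of the maximal ideal of `ξ`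
(`exists_pow_vanishing_le_ann`) and, if `w ≠ 0`, lies in this maximal ideal (`ann_le_vanishing`).
For pairwise distinct `ξ_i` the Chinese remainder theorem then gives
`Ann (∑ w_i e_{ξ_i}) = ⋂ Ann (w_i e_{ξ_i})` (`ann_sum_eq_iInf`). The homogeneous annihilator
consists of the polynomials all of whose homogeneous components annihilate (`mem_homAnn_iff`), so
the same decomposition holds for homogeneous annihilators.

Since the polynomials `w_i` of a generalized additive decomposition involve only `z_1, …, z_n`, and
`∂_1, …, ∂_n` commute with setting `x_0 = 1`, a polynomial annihilates the homogenized series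
exactly when its dehomogenization annihilates the affine one (`GAD.mem_ann_homSeries`). A form `p` is the
product of a power of `x_0` and the homogenization of its dehomogenization, which identifies the
homogeneous annihilator with the homogenization of the affine one (`homAnn_eq_homogenizeIdeal`);
and `x_0 p` has the same dehomogenization as `p`, whence the saturation (`isSaturated_homAnn`).

For the geometric part, the homogeneous annihilator `J` satisfies
`⋂ pointIdeal ξ_i ^ N_i ≤ J ≤ ⋂ pointIdeal ξ_i`; the upper bound uses that the `w_i` do not vanish,
which is where `ℓ_i ∤ ω_i` enters (`GAD.poly_ne_zero`). Each point ideal is the kernel of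
the restriction to a line (`ker_restrictLine`), with quotient `K[t]`. So every prime ideal over `J`
contains a point ideal, and is equal to it or maximal, which gives the dimension and the support.
-/

noncomputable section

namespace GADIdeal

variable {K : Type*} [Field K]

/-! ### Series as differential operators -/

section Functional

variable {σ : Type*}

theorem toFunctional_monomial (φ : MvPowerSeries σ K) (β : σ →₀ ℕ) :
    toFunctional φ (monomial β 1) = (multiFactorial β : K) * MvPowerSeries.coeff β φ := by
  have := (basisMonomials σ K).constr_basis K
    (fun α => (multiFactorial α : K) * MvPowerSeries.coeff α φ) β
  rwa [coe_basisMonomials] at this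

theorem toFunctional_add (φ ψ : MvPowerSeries σ K) :
    toFunctional (φ + ψ) = toFunctional φ + toFunctional ψ := by
  refine (basisMonomials σ K).ext fun β => ?_
  simp [toFunctional_monomial, mul_add]

theorem toFunctional_C_mul (a : K) (φ : MvPowerSeries σ K) :
    toFunctional (MvPowerSeries.C a * φ) = a • toFunctional φ := by
  refine (basisMonomials σ K).ext fun β => ?_
  simp [toFunctional_monomial, mul_left_comm]

theorem toFunctional_sum {ι : Type*} (s : Finset ι) (φ : ι → MvPowerSeries σ K) :
    toFunctional (∑ i ∈ s, φ i) = ∑ i ∈ s, toFunctional (φ i) := by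
  classical
  induction s using Finset.induction_on with
  | empty =>
    refine (basisMonomials σ K).ext fun β => ?_
    simp [toFunctional_monomial]
  | insert i s hi ih => rw [Finset.sum_insert hi, Finset.sum_insert hi, toFunctional_add, ih]

theorem multiFactorial_ne_zero [CharZero K] (β : σ →₀ ℕ) : (multiFactorial β : K) ≠ 0 := by
  rw [Nat.cast_ne_zero, multiFactorial, Finsupp.prod]
  exact Finset.prod_ne_zero_iff.2 fun j _ => Nat.factorial_ne_zero _

theorem toFunctional_injective [CharZero K] :
    Function.Injective (toFunctional : MvPowerSeries σ K → _) := by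
  intro φ ψ h
  ext β
  have := LinearMap.congr_fun h (monomial β 1)
  rw [toFunctional_monomial, toFunctional_monomial] at this
  exact mul_left_cancel₀ (multiFactorial_ne_zero β) this

theorem multiFactorial_add_single (β : σ →₀ ℕ) (i : σ) :
    multiFactorial (β + Finsupp.single i 1) = (β i + 1) * multiFactorial β := by
  classical
  have h1 := Finsupp.mul_prod_erase' (β + Finsupp.single i 1) i
    (fun _ (k : ℕ) => k.factorial) (fun _ => rfl)
  have h2 := Finsupp.mul_prod_erase' β i (fun _ (k : ℕ) => k.factorial) (fun _ => rfl)
  have h3 : (β + Finsupp.single i 1).erase i = β.erase i := by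
    ext j
    by_cases hj : j = i
    · simp [hj]
    · simp [Finsupp.erase_ne hj]
  rw [multiFactorial, multiFactorial, ← h1, ← h2, h3]
  simp [Nat.factorial_succ, mul_assoc]

/-- Multiplication of a series by the dual variable `z_i` is dual to `∂_i`. -/
theorem toFunctional_X_mul (φ : MvPowerSeries σ K) (i : σ) (q : MvPolynomial σ K) :
    toFunctional (MvPowerSeries.X i * φ) q = toFunctional φ (pderiv i q) := by
  classical
  suffices h : toFunctional (MvPowerSeries.X i * φ) =
      toFunctional φ ∘ₗ (pderiv i : Derivation K (MvPolynomial σ K) _).toLinearMap from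
    LinearMap.congr_fun h q
  refine (basisMonomials σ K).ext fun β => ?_
  rw [coe_basisMonomials, toFunctional_monomial, LinearMap.comp_apply]
  change _ = toFunctional φ (pderiv i (monomial β 1))
  rw [pderiv_monomial, one_mul]
  by_cases hβ : β i = 0
  · rw [hβ, Nat.cast_zero, monomial_zero, map_zero, MvPowerSeries.X,
      MvPowerSeries.coeff_monomial_mul, if_neg, mul_zero]
    rw [Finsupp.single_le_iff]
    omega
  · obtain ⟨γ, rfl⟩ : ∃ γ, β = γ + Finsupp.single i 1 :=
      ⟨β - Finsupp.single i 1, (tsub_add_cancel_of_le (by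
        rw [Finsupp.single_le_iff]; omega)).symm⟩
    rw [add_tsub_cancel_right, multiFactorial_add_single, add_comm γ, MvPowerSeries.X,
      MvPowerSeries.coeff_add_monomial_mul, one_mul]
    rw [show (monomial γ ((((Finsupp.single i 1 + γ : σ →₀ ℕ) i : ℕ) : K))) =
      (((Finsupp.single i 1 + γ : σ →₀ ℕ) i : ℕ) : K) • monomial γ (1 : K) by
        rw [smul_monomial, smul_eq_mul, mul_one], map_smul, toFunctional_monomial]
    simp
    ring

/-- The exponential series `e_ξ` represents evaluation at `ξ`. -/
theorem toFunctional_expSeries [CharZero K] (ξ : σ → K) (q : MvPolynomial σ K) :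
    toFunctional (expSeries ξ) q = eval ξ q := by
  suffices h : toFunctional (expSeries ξ) = (aeval ξ : MvPolynomial σ K →ₐ[K] K).toLinearMap by
    rw [h]; rfl
  refine (basisMonomials σ K).ext fun β => ?_
  rw [coe_basisMonomials, toFunctional_monomial, AlgHom.toLinearMap_apply, aeval_monomial, map_one,
    one_mul]
  exact mul_div_cancel₀ _ (multiFactorial_ne_zero β)

theorem toFunctional_C_mul_expSeries [CharZero K] (a : K) (ξ : σ → K) (q : MvPolynomial σ K) :
    toFunctional (((C a : MvPolynomial σ K) : MvPowerSeries σ K) * expSeries ξ) q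
      = a * eval ξ q := by
  rw [coe_C, toFunctional_C_mul, LinearMap.smul_apply, toFunctional_expSeries, smul_eq_mul]

theorem toFunctional_mul_X_mul (w : MvPolynomial σ K) (i : σ) (φ : MvPowerSeries σ K)
    (q : MvPolynomial σ K) :
    toFunctional (((w * X i : MvPolynomial σ K) : MvPowerSeries σ K) * φ) q
      = toFunctional ((w : MvPowerSeries σ K) * φ) (pderiv i q) := by
  rw [coe_mul, coe_X, mul_comm (w : MvPowerSeries σ K), mul_assoc, toFunctional_X_mul]

theorem mem_ann_iff {φ : MvPowerSeries σ K} {p : MvPolynomial σ K} :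
    p ∈ ann φ ↔ ∀ q, toFunctional φ (p * q) = 0 := by
  change coprod p φ = 0 ↔ _
  rw [LinearMap.ext_iff]
  rfl

end Functional

/-! ### Annihilators of polynomial-exponential series -/

section LocalAnnihilator

variable {σ : Type*}

/-- The maximal ideal of the polynomials vanishing at `ξ`. -/
def vanishing (ξ : σ → K) : Ideal (MvPolynomial σ K) := RingHom.ker (eval ξ)

theorem mem_vanishing {ξ : σ → K} {p : MvPolynomial σ K} : p ∈ vanishing ξ ↔ eval ξ p = 0 :=
  RingHom.mem_ker

instance vanishing_isMaximal (ξ : σ → K) : (vanishing ξ).IsMaximal :=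
  RingHom.ker_isMaximal_of_surjective _ fun a => ⟨C a, eval_C a⟩

theorem vanishing_injective : Function.Injective (vanishing : (σ → K) → _) := by
  intro ξ η h
  funext j
  have h1 : (X j - C (ξ j) : MvPolynomial σ K) ∈ vanishing ξ := by simp [mem_vanishing]
  rw [h, mem_vanishing] at h1
  simpa [sub_eq_zero, eq_comm] using h1

theorem derivation_mem_pow {A : Type*} [CommRing A] [Algebra K A] (D : Derivation K A A)
    (I : Ideal A) (N : ℕ) {q : A} (hq : q ∈ I ^ (N + 1)) : D q ∈ I ^ N := by
  induction N generalizing q with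
  | zero => simp
  | succ N ih =>
    rw [pow_succ] at hq
    induction hq using Submodule.mul_induction_on' with
    | mem_mul_mem a ha b hb =>
      rw [D.leibniz, smul_eq_mul, smul_eq_mul]
      refine add_mem (Ideal.mul_mem_right _ _ ha) ?_
      rw [mul_comm, pow_succ]
      exact Ideal.mul_mem_mul (ih ha) hb
    | add a _ b _ ha hb => rw [map_add]; exact add_mem ha hb

/-- The functional of `w(z) e_ξ(z)` evaluates a derivative of bounded order at `ξ`, so it kills
a power of the maximal ideal of `ξ`. -/
theorem exists_pow_vanishing_le_ann [CharZero K] (w : MvPolynomial σ K) (ξ : σ → K) :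
    ∃ N, vanishing ξ ^ N ≤ ann ((w : MvPowerSeries σ K) * expSeries ξ) := by
  suffices h : ∃ N, ∀ q ∈ vanishing ξ ^ N,
      toFunctional ((w : MvPowerSeries σ K) * expSeries ξ) q = 0 by
    obtain ⟨N, hN⟩ := h
    exact ⟨N, fun p hp => mem_ann_iff.2 fun q => hN _ (Ideal.mul_mem_right _ _ hp)⟩
  induction w using MvPolynomial.induction_on with
  | C a =>
    refine ⟨1, fun q hq => ?_⟩
    rw [pow_one, mem_vanishing] at hq
    rw [toFunctional_C_mul_expSeries, hq, mul_zero]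
  | add u v hu hv =>
    obtain ⟨M, hM⟩ := hu
    obtain ⟨N, hN⟩ := hv
    refine ⟨max M N, fun q hq => ?_⟩
    rw [coe_add, add_mul, toFunctional_add, LinearMap.add_apply,
      hM _ (Ideal.pow_le_pow_right (le_max_left _ _) hq),
      hN _ (Ideal.pow_le_pow_right (le_max_right _ _) hq), add_zero]
  | mul_X u i hu =>
    obtain ⟨N, hN⟩ := hu
    refine ⟨N + 1, fun q hq => ?_⟩
    rw [toFunctional_mul_X_mul]
    exact hN _ (derivation_mem_pow _ _ _ hq)

/-- An element not vanishing at `ξ` is a unit modulo every power of the maximal ideal of `ξ`,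
so it cannot annihilate a non-zero functional supported at `ξ`. -/
theorem ann_le_vanishing [CharZero K] {w : MvPolynomial σ K} (hw : w ≠ 0) (ξ : σ → K) :
    ann ((w : MvPowerSeries σ K) * expSeries ξ) ≤ vanishing ξ := by
  obtain ⟨N, hN⟩ := exists_pow_vanishing_le_ann w ξ
  have hexp : expSeries ξ ≠ 0 := by
    intro h
    have h1 := congrArg (MvPowerSeries.coeff 0) h
    rw [map_zero, MvPowerSeries.coeff_apply, expSeries] at h1
    simp [multiFactorial] at h1
  have hne : ann ((w : MvPowerSeries σ K) * expSeries ξ) ≠ ⊤ := by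
    rw [Ne, Ideal.eq_top_iff_one, mem_ann_iff]
    intro h
    have h0 : toFunctional ((w : MvPowerSeries σ K) * expSeries ξ) =
        toFunctional (0 : MvPowerSeries σ K) := by
      refine (basisMonomials σ K).ext fun β => ?_
      rw [coe_basisMonomials, toFunctional_monomial (0 : MvPowerSeries σ K), map_zero, mul_zero,
        ← h (monomial β 1), one_mul]
    refine mul_ne_zero ?_ hexp (toFunctional_injective h0)
    rwa [Ne, coe_eq_zero_iff]
  obtain ⟨M, hM, hle⟩ := Ideal.exists_le_maximal _ hne
  have h1 : vanishing ξ ≤ M := hM.isPrime.le_of_pow_le (hN.trans hle)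
  rwa [(vanishing_isMaximal ξ).eq_of_le hM.ne_top h1]

/-- Polynomial-exponential series with pairwise distinct frequencies are independent over the
polynomial ring. By the Chinese remainder theorem a polynomial congruent to `1` at one frequency
and to `0` at the others isolates the term of that frequency. -/
theorem ann_sum_eq_iInf [CharZero K] {ι : Type*} [Fintype ι] (w : ι → MvPolynomial σ K)
    (ξ : ι → σ → K) (hξ : Function.Injective ξ) :
    ann (∑ i, (w i : MvPowerSeries σ K) * expSeries (ξ i))
      = ⨅ i, ann ((w i : MvPowerSeries σ K) * expSeries (ξ i)) := by
  classical
  apply le_antisymm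
  · refine le_iInf fun i p hp => mem_ann_iff.2 fun q => ?_
    choose N hN using fun j => exists_pow_vanishing_le_ann (w j) (ξ j)
    have hco : IsCoprime (vanishing (ξ i) ^ N i)
        (⨅ j ∈ Finset.univ.erase i, vanishing (ξ j) ^ N j) :=
      Ideal.isCoprime_biInf fun j hj => IsCoprime.pow (Ideal.isCoprime_of_isMaximal fun h =>
        Finset.ne_of_mem_erase hj (hξ (vanishing_injective h)).symm)
    obtain ⟨a, ha, e, he, hae⟩ := Ideal.isCoprime_iff_exists.1 hco
    have h1 := mem_ann_iff.1 hp (q * e)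
    rw [toFunctional_sum, LinearMap.sum_apply, Finset.sum_eq_single i] at h1
    · rw [show p * q = p * (q * e) + a * (p * q) by
        linear_combination (-(p * q)) * hae, map_add, h1,
        mem_ann_iff.1 (hN i ha) (p * q), add_zero]
    · intro j _ hj
      have hej : e ∈ vanishing (ξ j) ^ N j := by
        simp only [Ideal.mem_iInf] at he
        exact he j (Finset.mem_erase.2 ⟨hj, Finset.mem_univ _⟩)
      rw [show p * (q * e) = e * (p * q) by ring]
      exact mem_ann_iff.1 (hN j hej) _
    · exact fun h => absurd (Finset.mem_univ _) h
  · intro p hp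
    rw [mem_ann_iff]
    intro q
    rw [toFunctional_sum, LinearMap.sum_apply]
    exact Finset.sum_eq_zero fun i _ => mem_ann_iff.1 (Ideal.mem_iInf.1 hp i) q

end LocalAnnihilator

/-! ### Homogeneous annihilators -/

section HomogeneousAnnihilator

variable {σ : Type*}

theorem homAnn_le_ann (φ : MvPowerSeries σ K) : homAnn φ ≤ ann φ :=
  Ideal.span_le.2 fun _ ⟨_, _, h⟩ => h

theorem homAnn_isHomogeneous (φ : MvPowerSeries σ K) :
    (homAnn φ).IsHomogeneous (homogeneousSubmodule σ K) :=
  Ideal.homogeneous_span _ _ fun _ ⟨k, hk, _⟩ => ⟨k, hk⟩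

theorem mem_homAnn_iff {φ : MvPowerSeries σ K} {p : MvPolynomial σ K} :
    p ∈ homAnn φ ↔ ∀ k, homogeneousComponent k p ∈ ann φ := by
  refine ⟨fun hp k => homAnn_le_ann φ
    (homogeneousComponent_mem_of_mem (homAnn_isHomogeneous φ) hp k), fun h => ?_⟩
  rw [← sum_homogeneousComponent p]
  exact sum_mem fun k _ => Ideal.subset_span ⟨k, homogeneousComponent_isHomogeneous k p, h k⟩

theorem le_homAnn {φ : MvPowerSeries σ K} {I : Ideal (MvPolynomial σ K)}
    (hI : I.IsHomogeneous (homogeneousSubmodule σ K)) (h : I ≤ ann φ) : I ≤ homAnn φ :=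
  fun _ hp => mem_homAnn_iff.2 fun k => h (homogeneousComponent_mem_of_mem hI hp k)

end HomogeneousAnnihilator

/-! ### Dehomogenization -/

section Dehomogenization

variable {n : ℕ}

/-- Dehomogenization: the substitution `x_0 = 1`. -/
def dehomogenize : MvPolynomial (Fin (n + 1)) K →ₐ[K] MvPolynomial (Fin n) K :=
  aeval (Fin.cons 1 X)

@[simp]
theorem dehomogenize_X_zero :
    dehomogenize (X 0 : MvPolynomial (Fin (n + 1)) K) = 1 := by
  simp [dehomogenize]

@[simp]
theorem dehomogenize_X_succ (j : Fin n) :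
    dehomogenize (X j.succ : MvPolynomial (Fin (n + 1)) K) = X j := by
  simp [dehomogenize]

@[simp]
theorem dehomogenize_rename_succ (p : MvPolynomial (Fin n) K) :
    dehomogenize (rename Fin.succ p) = p := by
  rw [dehomogenize, aeval_rename]
  exact aeval_X_left_apply p

theorem dehomogenize_surjective :
    Function.Surjective (dehomogenize : MvPolynomial (Fin (n + 1)) K → _) :=
  fun p => ⟨_, dehomogenize_rename_succ p⟩

theorem pderiv_dehomogenize (j : Fin n) (q : MvPolynomial (Fin (n + 1)) K) :
    pderiv j (dehomogenize q) = dehomogenize (pderiv j.succ q) := by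
  induction q using MvPolynomial.induction_on with
  | C a => simp [dehomogenize]
  | add p q hp hq => simp only [map_add, hp, hq]
  | mul_X p i hp =>
    simp only [map_mul, Derivation.leibniz, smul_eq_mul, map_add, hp]
    congr 2
    refine Fin.cases ?_ (fun i => ?_) i
    · rw [dehomogenize_X_zero, pderiv_X_of_ne (Fin.succ_ne_zero j).symm, map_zero,
        ← C_1, pderiv_C]
    · rw [dehomogenize_X_succ]
      by_cases hij : i = j
      · subst hij
        rw [pderiv_X_self, pderiv_X_self, map_one]
      · rw [pderiv_X_of_ne hij, pderiv_X_of_ne (by simpa using hij), map_zero]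

theorem eval_tail_dehomogenize {ξ : Fin (n + 1) → K} (hξ : ξ 0 = 1)
    (q : MvPolynomial (Fin (n + 1)) K) : eval (Fin.tail ξ) (dehomogenize q) = eval ξ q := by
  induction q using MvPolynomial.induction_on with
  | C a => simp [dehomogenize]
  | add p q hp hq => simp only [map_add, hp, hq]
  | mul_X p i hp =>
    simp only [map_mul, hp]
    congr 1
    refine Fin.cases ?_ (fun i => ?_) i
    · simp [hξ]
    · simp [Fin.tail]

/-- The functional of `w(z_1, …, z_n) e_{(1, ξ)}` takes on `q` the value that the functional of
`w e_ξ` takes on the dehomogenization of `q`, since `∂_1, …, ∂_n` commute with setting `x_0 = 1`. -/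
theorem toFunctional_rename_mul_expSeries [CharZero K] (w : MvPolynomial (Fin n) K)
    {ξ : Fin (n + 1) → K} (hξ : ξ 0 = 1) (q : MvPolynomial (Fin (n + 1)) K) :
    toFunctional (((rename Fin.succ w : MvPolynomial (Fin (n + 1)) K) :
        MvPowerSeries (Fin (n + 1)) K) * expSeries ξ) q
      = toFunctional ((w : MvPowerSeries (Fin n) K) * expSeries (Fin.tail ξ))
          (dehomogenize q) := by
  induction w using MvPolynomial.induction_on generalizing q with
  | C a =>
    rw [rename_C, toFunctional_C_mul_expSeries, toFunctional_C_mul_expSeries,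
      eval_tail_dehomogenize hξ]
  | add u v hu hv =>
    rw [map_add, coe_add, coe_add, add_mul, add_mul, toFunctional_add, toFunctional_add,
      LinearMap.add_apply, LinearMap.add_apply, hu, hv]
  | mul_X u i hu =>
    rw [map_mul, rename_X, toFunctional_mul_X_mul, toFunctional_mul_X_mul, hu, pderiv_dehomogenize]

theorem dehomogenize_homogenizeDeg (d : ℕ) (p : MvPolynomial (Fin n) K) :
    dehomogenize (homogenizeDeg d p) = p := by
  conv_rhs => rw [p.as_sum]
  rw [homogenizeDeg, map_sum]
  refine Finset.sum_congr rfl fun α _ => ?_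
  rw [map_mul, map_mul, map_pow, dehomogenize_X_zero, one_pow, mul_one, dehomogenize_rename_succ,
    ← algebraMap_eq, AlgHom.commutes, algebraMap_eq, C_mul_monomial, mul_one]

theorem homogenizeDeg_isHomogeneous {d : ℕ} {p : MvPolynomial (Fin n) K} (hd : p.totalDegree ≤ d) :
    (homogenizeDeg d p).IsHomogeneous d := by
  refine IsHomogeneous.sum _ _ _ fun α hα => ?_
  have hα' : α.degree ≤ d := (le_totalDegree hα).trans hd
  have h := ((isHomogeneous_C (Fin (n + 1)) (p.coeff α)).mul
    ((isHomogeneous_X K (0 : Fin (n + 1))).pow (d - α.degree))).mul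
    ((isHomogeneous_monomial (1 : K) (rfl : α.degree = α.degree)).rename_isHomogeneous
      (f := Fin.succ))
  rwa [show 0 + 1 * (d - α.degree) + α.degree = d by omega] at h

theorem dehomogenize_monomial (β : Fin (n + 1) →₀ ℕ) (a : K) :
    dehomogenize (monomial β a) = monomial β.tail a := by
  rw [dehomogenize, aeval_monomial, Finsupp.prod_fintype _ _ (fun _ => pow_zero _),
    Fin.prod_univ_succ, monomial_eq, Finsupp.prod_fintype _ _ (fun _ => pow_zero _)]
  simp [algebraMap_eq, Finsupp.tail_apply]

theorem degree_eq_add_degree_tail (β : Fin (n + 1) →₀ ℕ) :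
    β.degree = β 0 + β.tail.degree := by
  rw [Finsupp.degree_eq_sum, Finsupp.degree_eq_sum, Fin.sum_univ_succ]
  rfl

/-- A form is determined by its degree and its dehomogenization. -/
theorem eq_of_dehomogenize_eq {k : ℕ} {p q : MvPolynomial (Fin (n + 1)) K}
    (hp : p.IsHomogeneous k) (hq : q.IsHomogeneous k) (h : dehomogenize p = dehomogenize q) :
    p = q := by
  suffices key : ∀ p : MvPolynomial (Fin (n + 1)) K, p.IsHomogeneous k →
      ∀ α : Fin (n + 1) →₀ ℕ, α.degree = k → coeff α.tail (dehomogenize p) = coeff α p by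
    ext α
    by_cases hα : α.degree = k
    · rw [← key p hp α hα, ← key q hq α hα, h]
    · rw [hp.coeff_eq_zero hα, hq.coeff_eq_zero hα]
  intro p hp α hα
  conv_lhs => rw [p.as_sum, map_sum, coeff_sum]
  conv_rhs => rw [p.as_sum, coeff_sum]
  refine Finset.sum_congr rfl fun β hβ => ?_
  rw [dehomogenize_monomial, coeff_monomial, coeff_monomial]
  have hβk : β.degree = k := by
    by_contra hne
    exact mem_support_iff.1 hβ (hp.coeff_eq_zero hne)
  congr 1
  refine propext ⟨fun h1 => ?_, fun h1 => by rw [h1]⟩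
  have h0 : β 0 = α 0 := by
    have h2 := degree_eq_add_degree_tail α
    have h3 := degree_eq_add_degree_tail β
    rw [h1] at h3
    omega
  rw [← Finsupp.cons_tail β, ← Finsupp.cons_tail α, h0, h1]

/-- The forms annihilating `ψ` are the multiples by powers of `x_0` of
the homogenizations of the elements of `ann φ`. -/
theorem homAnn_eq_homogenizeIdeal {ψ : MvPowerSeries (Fin (n + 1)) K}
    {φ : MvPowerSeries (Fin n) K} (h : ∀ p, p ∈ ann ψ ↔ dehomogenize p ∈ ann φ) :
    homAnn ψ = homogenizeIdeal (ann φ) := by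
  apply le_antisymm
  · refine Ideal.span_le.2 fun p ⟨k, hk, hp⟩ => ?_
    have hp' : dehomogenize p ∈ ann φ := (h p).1 hp
    have hdeg : (dehomogenize p).totalDegree ≤ k := by
      rw [p.as_sum, map_sum]
      refine totalDegree_finsetSum_le fun α hα => ?_
      have hαk : α.degree = k := by
        by_contra hne
        exact mem_support_iff.1 hα (hk.coeff_eq_zero hne)
      rw [dehomogenize_monomial]
      refine (totalDegree_monomial_le _ _).trans ?_
      change α.tail.degree ≤ k
      have := degree_eq_add_degree_tail α
      omega
    have : p = X 0 ^ (k - (dehomogenize p).totalDegree) *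
        homogenizeDeg (dehomogenize p).totalDegree (dehomogenize p) := by
      refine eq_of_dehomogenize_eq hk ?_ ?_
      · have h1 := ((isHomogeneous_X K (0 : Fin (n + 1))).pow
          (k - (dehomogenize p).totalDegree)).mul
          (homogenizeDeg_isHomogeneous (le_refl (dehomogenize p).totalDegree))
        rwa [one_mul, Nat.sub_add_cancel hdeg] at h1
      · rw [map_mul, map_pow, dehomogenize_X_zero, one_pow, one_mul, dehomogenize_homogenizeDeg]
    rw [this]
    exact Ideal.mul_mem_left _ _ (Ideal.subset_span ⟨_, hp', rfl⟩)
  · refine Ideal.span_le.2 ?_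
    rintro _ ⟨p, hp, rfl⟩
    refine Ideal.subset_span ⟨p.totalDegree, homogenizeDeg_isHomogeneous le_rfl, ?_⟩
    refine (h _).2 ?_
    rwa [dehomogenize_homogenizeDeg]

theorem homogeneousComponent_X_mul {σ : Type*} (i : σ) (p : MvPolynomial σ K) (k : ℕ) :
    homogeneousComponent (k + 1) (X i * p) = X i * homogeneousComponent k p := by
  classical
  ext α
  rw [coeff_homogeneousComponent, coeff_X_mul', coeff_X_mul', coeff_homogeneousComponent]
  by_cases hi : i ∈ α.support
  · obtain ⟨γ, rfl⟩ : ∃ γ, α = γ + Finsupp.single i 1 :=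
      ⟨α - Finsupp.single i 1, (tsub_add_cancel_of_le (by
        rw [Finsupp.single_le_iff]; exact Nat.one_le_iff_ne_zero.2 (by simpa using hi))).symm⟩
    rw [add_tsub_cancel_right, map_add, Finsupp.degree_single]
    simp [hi]
  · simp [hi]

theorem isSaturated_homAnn {ψ : MvPowerSeries (Fin (n + 1)) K}
    {φ : MvPowerSeries (Fin n) K} (h : ∀ p, p ∈ ann ψ ↔ dehomogenize p ∈ ann φ) :
    IsSaturated (homAnn ψ) := by
  apply le_antisymm
  · intro p hp
    have h1 : p * X 0 ∈ homAnn ψ :=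
      Submodule.mem_colon.1 hp _ (Ideal.subset_span ⟨0, rfl⟩)
    rw [mem_homAnn_iff] at h1 ⊢
    intro k
    have h2 := (h _).1 (h1 (k + 1))
    rw [mul_comm, homogeneousComponent_X_mul, map_mul, dehomogenize_X_zero, one_mul] at h2
    exact (h _).2 h2
  · exact fun p hp => Submodule.mem_colon.2 fun q _ => Ideal.mul_mem_right _ _ hp

end Dehomogenization

/-! ### Ideals of projective points -/

section PointIdeal

variable {n : ℕ}

theorem pointIdeal_isHomogeneous (ξ : Fin (n + 1) → K) :
    (pointIdeal ξ).IsHomogeneous (homogeneousSubmodule (Fin (n + 1)) K) := by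
  refine Ideal.homogeneous_span _ _ ?_
  rintro _ ⟨jk, rfl⟩
  exact ⟨1, (isHomogeneous_C_mul_X _ _).sub (isHomogeneous_C_mul_X _ _)⟩

/-- The restriction `x_j ↦ ξ_j t` of polynomials to the line spanned by `ξ`, with
parameter `t`. -/
def restrictLine (ξ : Fin (n + 1) → K) : MvPolynomial (Fin (n + 1)) K →ₐ[K] Polynomial K :=
  aeval fun j => Polynomial.C (ξ j) * Polynomial.X

theorem restrictLine_X (ξ : Fin (n + 1) → K) (j : Fin (n + 1)) :
    restrictLine ξ (X j) = Polynomial.C (ξ j) * Polynomial.X := by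
  rw [restrictLine, aeval_X]

theorem restrictLine_X_zero {ξ : Fin (n + 1) → K} (hξ : ξ 0 = 1) :
    restrictLine ξ (X 0) = Polynomial.X := by
  rw [restrictLine_X, hξ, Polynomial.C_1, one_mul]

theorem restrictLine_surjective {ξ : Fin (n + 1) → K} (hξ : ξ 0 = 1) :
    Function.Surjective (restrictLine ξ) := by
  intro q
  refine ⟨Polynomial.aeval (X 0) q, ?_⟩
  rw [← Polynomial.aeval_algHom_apply, restrictLine_X_zero hξ, Polynomial.aeval_X_left_apply]

theorem ker_restrictLine {ξ : Fin (n + 1) → K} (hξ : ξ 0 = 1) :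
    RingHom.ker (restrictLine ξ) = pointIdeal ξ := by
  apply le_antisymm
  · intro p hp
    -- modulo the forms `x_j - ξ_j x_0`, every polynomial equals its restriction to the line,
    -- with `x_0` as the parameter
    have key : ((Ideal.Quotient.mkₐ K (pointIdeal ξ)).comp
        (Polynomial.aeval (X 0 : MvPolynomial (Fin (n + 1)) K))).comp (restrictLine ξ) =
        Ideal.Quotient.mkₐ K (pointIdeal ξ) := by
      refine MvPolynomial.algHom_ext fun j => ?_
      rw [AlgHom.comp_apply, AlgHom.comp_apply, restrictLine_X, map_mul, Polynomial.aeval_C,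
        Polynomial.aeval_X, algebraMap_eq]
      refine (Ideal.Quotient.mk_eq_mk_iff_sub_mem _ _).2 (Ideal.subset_span ⟨(j, 0), ?_⟩)
      simp [hξ]
    have h1 := AlgHom.congr_fun key p
    rw [AlgHom.comp_apply, RingHom.mem_ker.1 hp, map_zero] at h1
    exact Ideal.Quotient.eq_zero_iff_mem.1 h1.symm
  · refine Ideal.span_le.2 ?_
    rintro _ ⟨jk, rfl⟩
    refine RingHom.mem_ker.2 ?_
    rw [map_sub, map_mul, map_mul, restrictLine_X, restrictLine_X, ← algebraMap_eq,
      AlgHom.commutes, AlgHom.commutes, Polynomial.algebraMap_eq]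
    ring

theorem pointIdeal_isPrime {ξ : Fin (n + 1) → K} (hξ : ξ 0 = 1) : (pointIdeal ξ).IsPrime := by
  rw [← ker_restrictLine hξ]
  exact RingHom.ker_isPrime _

theorem X_zero_notMem_pointIdeal {ξ : Fin (n + 1) → K} (hξ : ξ 0 = 1) :
    X 0 ∉ pointIdeal ξ := by
  rw [← ker_restrictLine hξ, RingHom.mem_ker, restrictLine_X_zero hξ]
  exact Polynomial.X_ne_zero

theorem pointIdeal_le_vanishing (ξ : Fin (n + 1) → K) : pointIdeal ξ ≤ vanishing ξ := by
  refine Ideal.span_le.2 ?_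
  rintro _ ⟨jk, rfl⟩
  refine mem_vanishing.2 ?_
  simp [mul_comm]

/-- A form of degree `k` restricts to the line spanned by `ξ` as `p(ξ) t ^ k`. -/
theorem restrictLine_of_isHomogeneous (ξ : Fin (n + 1) → K) {k : ℕ}
    {p : MvPolynomial (Fin (n + 1)) K} (hp : p.IsHomogeneous k) :
    restrictLine ξ p = Polynomial.C (eval ξ p) * Polynomial.X ^ k := by
  conv_lhs => rw [p.as_sum]
  rw [map_sum, eval_eq', map_sum, Finset.sum_mul]
  refine Finset.sum_congr rfl fun α hα => ?_
  have hαk : α.degree = k := by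
    by_contra hne
    exact mem_support_iff.1 hα (hp.coeff_eq_zero hne)
  rw [restrictLine, aeval_monomial, Finsupp.prod_fintype _ _ (fun _ => pow_zero _),
    Polynomial.algebraMap_eq, ← hαk, Finsupp.degree_eq_sum]
  simp only [mul_pow, Finset.prod_mul_distrib, Finset.prod_pow_eq_pow_sum, map_mul, map_prod,
    map_pow, mul_assoc]

/-- A homogeneous ideal of polynomials vanishing at a representative of a projective point lies in
the ideal of this point. -/
theorem le_pointIdeal {ξ : Fin (n + 1) → K} (hξ : ξ 0 = 1)
    {I : Ideal (MvPolynomial (Fin (n + 1)) K)}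
    (hI : I.IsHomogeneous (homogeneousSubmodule (Fin (n + 1)) K)) (h : I ≤ vanishing ξ) :
    I ≤ pointIdeal ξ := by
  intro p hp
  rw [← sum_homogeneousComponent p]
  refine sum_mem fun k _ => ?_
  rw [← ker_restrictLine hξ, RingHom.mem_ker,
    restrictLine_of_isHomogeneous ξ (homogeneousComponent_isHomogeneous k p),
    mem_vanishing.1 (h (homogeneousComponent_mem_of_mem hI hp k)), Polynomial.C_0, zero_mul]

/-- The point ideals are maximal among the homogeneous primes without `x_0`. -/
theorem eq_pointIdeal_of_le {ξ : Fin (n + 1) → K} (hξ : ξ 0 = 1)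
    {P : Ideal (MvPolynomial (Fin (n + 1)) K)} [hP : P.IsPrime]
    (hhom : P.IsHomogeneous (homogeneousSubmodule (Fin (n + 1)) K)) (hle : pointIdeal ξ ≤ P)
    (hX : X 0 ∉ P) : P = pointIdeal ξ := by
  refine le_antisymm (le_pointIdeal hξ hhom fun p hp => ?_) hle
  rw [← sum_homogeneousComponent p]
  refine sum_mem fun k _ => ?_
  by_contra hne
  rw [mem_vanishing] at hne
  have hpk := homogeneousComponent_isHomogeneous k p
  have h1 : homogeneousComponent k p - C (eval ξ (homogeneousComponent k p)) * X 0 ^ k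
      ∈ pointIdeal ξ := by
    rw [← ker_restrictLine hξ, RingHom.mem_ker, map_sub, map_mul, map_pow, restrictLine_X_zero hξ,
      restrictLine_of_isHomogeneous ξ hpk, ← algebraMap_eq, AlgHom.commutes,
      Polynomial.algebraMap_eq, sub_self]
  have h2 := (Submodule.sub_mem_iff_right P (homogeneousComponent_mem_of_mem hhom hp k)).1 (hle h1)
  have h3 := Ideal.mul_mem_left P (C (eval ξ (homogeneousComponent k p))⁻¹) h2
  rw [← mul_assoc, ← C_mul, inv_mul_cancel₀ hne, C_1, one_mul] at h3
  exact hX (hP.mem_of_pow_mem _ h3)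

theorem X_zero_notMem_of_pointIdeal_le {ξ : Fin (n + 1) → K} (hξ : ξ 0 = 1)
    {P : HomogeneousIdeal (homogeneousSubmodule (Fin (n + 1)) K)} (hle : pointIdeal ξ ≤ P.toIdeal)
    (hirr : ¬HomogeneousIdeal.irrelevant (homogeneousSubmodule (Fin (n + 1)) K) ≤ P) :
    X 0 ∉ P.toIdeal := by
  intro hX
  refine hirr fun p hp => ?_
  have hXj : ∀ j, (X j : MvPolynomial (Fin (n + 1)) K) ∈ P.toIdeal := by
    intro j
    have h1 : C (ξ 0) * X j - C (ξ j) * X 0 ∈ P.toIdeal := hle (Ideal.subset_span ⟨(0, j), rfl⟩)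
    rw [hξ, C_1, one_mul] at h1
    exact (Submodule.sub_mem_iff_left _ (Ideal.mul_mem_left _ _ hX)).1 h1
  have h0 : coeff 0 p = 0 := by
    have h1 := (HomogeneousIdeal.mem_irrelevant_iff _ p).1 hp
    rw [GradedRing.proj_apply] at h1
    have h2 : homogeneousComponent 0 p = 0 := (decomposition.decompose'_apply p 0).symm.trans h1
    rwa [homogeneousComponent_zero, C_eq_zero] at h2
  have hspan : p ∈ Ideal.span (X '' Set.univ) := by
    rw [mem_ideal_span_X_image]
    intro α hα
    by_contra! hzero
    have : α = 0 := Finsupp.ext fun j => hzero j (Set.mem_univ j)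
    exact mem_support_iff.1 hα (this ▸ h0)
  refine Ideal.span_le.2 ?_ hspan
  rintro _ ⟨j, -, rfl⟩
  exact hXj j

theorem isMaximal_of_pointIdeal_lt {ξ : Fin (n + 1) → K} (hξ : ξ 0 = 1)
    {P : Ideal (MvPolynomial (Fin (n + 1)) K)} [hP : P.IsPrime] (hlt : pointIdeal ξ < P) :
    P.IsMaximal := by
  have hsurj := restrictLine_surjective hξ
  have hker : RingHom.ker (restrictLine ξ) ≤ P := (ker_restrictLine hξ).trans_le hlt.le
  have hcomap : (P.map (restrictLine ξ)).comap (restrictLine ξ) = P :=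
    (Ideal.comap_map_of_surjective' (restrictLine ξ) hsurj P).trans (sup_eq_left.2 hker)
  have hprime : (P.map (restrictLine ξ)).IsPrime :=
    Ideal.map_isPrime_of_surjective hsurj hker
  have hne : P.map (restrictLine ξ) ≠ ⊥ := by
    intro h
    rw [h] at hcomap
    exact hlt.ne ((ker_restrictLine hξ).symm.trans hcomap)
  have := hprime.isMaximal hne
  rw [← hcomap]
  exact Ideal.comap_isMaximal_of_surjective _ hsurj

end PointIdeal

/-! ### Ideals cutting out finitely many points -/

section ProjectiveScheme

variable {n : ℕ} {ι : Type*} {ξ : ι → Fin (n + 1) → K}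

theorem isHomogeneous_pow {σ : Type*} {I : Ideal (MvPolynomial σ K)}
    (hI : I.IsHomogeneous (homogeneousSubmodule σ K)) (N : ℕ) :
    (I ^ N).IsHomogeneous (homogeneousSubmodule σ K) := by
  induction N with
  | zero => rw [pow_zero, Ideal.one_eq_top]; exact Ideal.IsHomogeneous.top _
  | succ N ih => rw [pow_succ]; exact ih.mul hI

/-- The points `ξ_i` cut out the zero set of `J`: every prime ideal containing `J` contains
one of the point ideals. -/
theorem exists_pointIdeal_le [Fintype ι] {J : Ideal (MvPolynomial (Fin (n + 1)) K)} (N : ι → ℕ)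
    (hJ : ⨅ i, pointIdeal (ξ i) ^ N i ≤ J) {P : Ideal (MvPolynomial (Fin (n + 1)) K)}
    [hP : P.IsPrime] (hle : J ≤ P) : ∃ i, pointIdeal (ξ i) ≤ P := by
  have h1 : Finset.univ.inf (fun i => pointIdeal (ξ i) ^ N i) ≤ P := by
    rw [Finset.inf_univ_eq_iInf]
    exact hJ.trans hle
  obtain ⟨i, -, hi⟩ := (hP.inf_le' (s := Finset.univ)).1 h1
  exact ⟨i, hP.le_of_pow_le hi⟩

theorem isProjZeroDimensional_of_le [Fintype ι] [Nonempty ι] (hξ : ∀ i, ξ i 0 = 1)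
    {J : Ideal (MvPolynomial (Fin (n + 1)) K)} (N : ι → ℕ)
    (hJ : ⨅ i, pointIdeal (ξ i) ^ N i ≤ J) (hle : ∀ i, J ≤ pointIdeal (ξ i)) :
    IsProjZeroDimensional J := by
  apply le_antisymm
  · rw [ringKrullDim_quotient, Order.krullDim_le_one_iff]
    rintro ⟨P, hP⟩
    rw [or_iff_not_imp_left]
    intro hmin
    obtain ⟨⟨Q, hQ⟩, hlt⟩ := not_isMin_iff.1 hmin
    obtain ⟨i, hi⟩ := exists_pointIdeal_le (ξ := ξ) N hJ (P := Q.asIdeal) hQ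
    have hPmax : P.asIdeal.IsMaximal := isMaximal_of_pointIdeal_lt (hξ i)
      (hi.trans_lt (show Q.asIdeal < P.asIdeal from hlt))
    rintro ⟨M, hM⟩ hPM
    exact (hPmax.eq_of_le M.isPrime.ne_top hPM).ge
  · obtain ⟨i⟩ := ‹Nonempty ι›
    have hker : ∀ p ∈ J, restrictLine (ξ i) p = 0 := fun p hp =>
      RingHom.mem_ker.1 ((ker_restrictLine (hξ i)).ge (hle i hp))
    rw [← IsPrincipalIdealRing.ringKrullDim_eq_one (Polynomial K) (Polynomial.not_isField K)]
    exact ringKrullDim_le_of_surjective (Ideal.Quotient.lift J (restrictLine (ξ i)).toRingHom hker)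
      (Ideal.Quotient.lift_surjective_of_surjective _ _ (restrictLine_surjective (hξ i)))

theorem projSupport_eq_range [Fintype ι] (hξ : ∀ i, ξ i 0 = 1)
    {J : Ideal (MvPolynomial (Fin (n + 1)) K)} (N : ι → ℕ)
    (hJ : ⨅ i, pointIdeal (ξ i) ^ N i ≤ J) (hle : ∀ i, J ≤ pointIdeal (ξ i)) :
    projSupport J = Set.range fun i => pointIdeal (ξ i) := by
  ext I
  constructor
  · rintro ⟨P, hP, rfl⟩
    obtain ⟨i, hi⟩ := exists_pointIdeal_le (ξ := ξ) N hJ (P := P.asHomogeneousIdeal.toIdeal) hP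
    exact ⟨i, (eq_pointIdeal_of_le (hξ i) P.asHomogeneousIdeal.isHomogeneous hi
      (X_zero_notMem_of_pointIdeal_le (hξ i) hi P.not_irrelevant_le)).symm⟩
  · rintro ⟨i, rfl⟩
    refine ⟨⟨⟨pointIdeal (ξ i), pointIdeal_isHomogeneous _⟩, pointIdeal_isPrime (hξ i),
      fun h => ?_⟩, hle i, rfl⟩
    exact X_zero_notMem_pointIdeal (hξ i)
      (h (HomogeneousIdeal.mem_irrelevant_of_mem _ one_pos (isHomogeneous_X K 0)))

end ProjectiveScheme

/-! ### Series of a generalized additive decomposition -/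

namespace GAD

variable {n d s : ℕ} {f : MvPolynomial (Fin (n + 1)) K}

theorem point_injective (G : GAD d s f) : Function.Injective G.point := by
  intro i j hij
  by_contra hne
  exact G.not_proportional i j hne 1 (by rw [hij, one_smul])

/-- Some component `ω_{i,j}` is non-zero as `ℓ_i ∤ ω_i`, and no cancellation occurs in `poly`:
the components have distinct degrees and the factors `(d - j)!` are non-zero. -/
theorem poly_ne_zero [CharZero K] (G : GAD d s f) {i : Fin s} (hi : G.point i 0 = 1) :
    G.poly i ≠ 0 := by
  intro h
  refine G.not_dvd i ?_
  suffices h0 : ∀ j ∈ Finset.range (G.k i + 1), component (G.point i) (G.k i) (G.ω i) j = 0 by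
    rw [sum_component (G.point i) (hi.trans_ne one_ne_zero) (G.ω_homogeneous i),
      Finset.sum_eq_zero fun j hj => by rw [h0 j hj, map_zero, zero_mul]]
    exact dvd_zero _
  have hfac : ∀ m : ℕ, (m.factorial : K) ≠ 0 := fun m =>
    Nat.cast_ne_zero.2 (Nat.factorial_ne_zero m)
  have hsum : ∑ j ∈ Finset.range (G.k i + 1),
      C ((d - j).factorial : K) * component (G.point i) (G.k i) (G.ω i) j = 0 :=
    (mul_eq_zero.1 h).resolve_left (C_ne_zero.2 (inv_ne_zero (hfac d)))
  have hhom : ∀ j ∈ Finset.range (G.k i + 1),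
      (component (G.point i) (G.k i) (G.ω i) j).IsHomogeneous j := fun j hj =>
    component_isHomogeneous _ (G.ω_homogeneous i) (Nat.lt_succ_iff.1 (Finset.mem_range.1 hj))
  intro j hj
  have h1 := congrArg (homogeneousComponent j) hsum
  rw [map_sum, map_zero, Finset.sum_eq_single j] at h1
  · rw [homogeneousComponent_C_mul, homogeneousComponent_of_mem (hhom j hj), if_pos rfl] at h1
    exact (mul_eq_zero.1 h1).resolve_left (C_ne_zero.2 (hfac _))
  · intro m hm hmj
    rw [homogeneousComponent_C_mul, homogeneousComponent_of_mem (hhom m hm), if_neg hmj.symm,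
      mul_zero]
  · exact fun hn => absurd hj hn

theorem mem_ann_homSeries [CharZero K] (G : GAD d s f) (hG : ∀ i, G.point i 0 = 1)
    (p : MvPolynomial (Fin (n + 1)) K) :
    p ∈ ann G.homSeries ↔ dehomogenize p ∈ ann G.affineSeries := by
  have key : ∀ q, toFunctional G.homSeries q = toFunctional G.affineSeries (dehomogenize q) := by
    intro q
    rw [homSeries, affineSeries, toFunctional_sum, toFunctional_sum, LinearMap.sum_apply,
      LinearMap.sum_apply]
    exact Finset.sum_congr rfl fun i _ => toFunctional_rename_mul_expSeries _ (hG i) q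
  rw [mem_ann_iff, mem_ann_iff, (dehomogenize_surjective (K := K) (n := n)).forall]
  simp only [key, map_mul]

theorem homAnn_homSeries_eq_iInf [CharZero K] (G : GAD d s f) :
    homAnn G.homSeries = ⨅ i, homAnn (G.homTerm i) := by
  have h : ann G.homSeries = ⨅ i, ann (G.homTerm i) :=
    ann_sum_eq_iInf (fun i => rename Fin.succ (G.poly i)) G.point G.point_injective
  ext p
  simp only [mem_homAnn_iff, h, Ideal.mem_iInf]
  exact forall_comm

theorem homAnn_homTerm_le_pointIdeal [CharZero K] (G : GAD d s f) {i : Fin s}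
    (hi : G.point i 0 = 1) : homAnn (G.homTerm i) ≤ pointIdeal (G.point i) :=
  le_pointIdeal hi (homAnn_isHomogeneous _) ((homAnn_le_ann _).trans (ann_le_vanishing
    ((map_ne_zero_iff _ (rename_injective _ (Fin.succ_injective n))).2 (G.poly_ne_zero hi)) _))

theorem exists_pointIdeal_pow_le_homAnn [CharZero K] (G : GAD d s f) (i : Fin s) :
    ∃ N, pointIdeal (G.point i) ^ N ≤ homAnn (G.homTerm i) := by
  obtain ⟨N, hN⟩ := exists_pow_vanishing_le_ann (rename Fin.succ (G.poly i)) (G.point i)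
  exact ⟨N, le_homAnn (isHomogeneous_pow (pointIdeal_isHomogeneous _) N)
    ((Ideal.pow_right_mono (pointIdeal_le_vanishing _) N).trans hN)⟩

end GAD

end GADIdeal

end

theorem mainTheorem7 {K : Type*} [Field K] [CharZero K] {n d s : ℕ} (hs : 0 < s)
    {f : MvPolynomial (Fin (n + 1)) K} (G : GADIdeal.GAD d s f)
    (hG : ∀ i, G.point i 0 = 1) :
    GADIdeal.IsSaturated (GADIdeal.homAnn G.homSeries) ∧
    GADIdeal.IsProjZeroDimensional (GADIdeal.homAnn G.homSeries) ∧
    GADIdeal.projSupport (GADIdeal.homAnn G.homSeries) =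
      Set.range (fun i => GADIdeal.pointIdeal (G.point i)) ∧
    GADIdeal.homAnn G.homSeries =
      GADIdeal.homogenizeIdeal (GADIdeal.ann G.affineSeries) ∧
    GADIdeal.homAnn G.homSeries = ⨅ i, GADIdeal.homAnn (G.homTerm i) := by
  have : Nonempty (Fin s) := ⟨⟨0, hs⟩⟩
  choose N hN using G.exists_pointIdeal_pow_le_homAnn
  have hinf := G.homAnn_homSeries_eq_iInf
  have hJ : ⨅ i, GADIdeal.pointIdeal (G.point i) ^ N i ≤ GADIdeal.homAnn G.homSeries :=
    (iInf_mono hN).trans hinf.ge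
  have hle : ∀ i, GADIdeal.homAnn G.homSeries ≤ GADIdeal.pointIdeal (G.point i) := fun i =>
    hinf.le.trans ((iInf_le _ i).trans (G.homAnn_homTerm_le_pointIdeal (hG i)))
  have hann := G.mem_ann_homSeries hG
  exact ⟨GADIdeal.isSaturated_homAnn hann, GADIdeal.isProjZeroDimensional_of_le hG N hJ hle,
    GADIdeal.projSupport_eq_range hG N hJ hle, GADIdeal.homAnn_eq_homogenizeIdeal hann, hinf⟩
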